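/- Write $2^{\mathbb N}$ for the set of functions $\mathbb N\to\{0,1\}$, and $\le_T$, $\equiv_T$ for Turing reducibility and equivalence. A property holds *for all $x$ on a cone* if there is $b\in 2^{\mathbb N}$ such that it holds for every $x\ge_T b$. A set $A\subseteq 2^{\mathbb N}$ is *determined* if one of the two players has a winning strategy in the game in which players I and II alternately choose the bits $z(0),z(1),z(2),\dots$ and I wins if and only if $z\in A$; the axiom of determinacy (AD) says that every $A\subseteq 2^{\mathbb N}$ is determined. A hypothesis class is a set $\mathcal H\subseteq 2^{\mathbb N}$, a sample is a finite sequence of elements of $\mathbb N\times\{0,1\}$, and a learner is a map $A$ from samples to $2^{\mathbb N}$. For a probability distribution $D$ on $\mathbb N\times\{0,1\}$ let $L_D(h)=\Pr_{(n,y)\sim D}[h(n)\ne y]$. A learner $A$ and a sample size function $m:(0,1)^2\to\mathbb N$ *witness PAC learnability* of $\mathcal H$ if for every $D$, all $\varepsilon,\delta\in(0,1)$ and all $n\ge m(\varepsilon,\delta)$, $$\Pr_{S\sim D^n}\big[\,L_D(A(S))\le L_D(h)+\varepsilon\ \text{ for all } h\in\mathcal H\,\big]\ \ge\ 1-\delta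 .$$ The class $\mathcal H$ is *PAC-learnable* if such $A$ and $m$ exist with $A(S)\in\mathcal H$ for every sample $S$. It is *improperly SCPAC-learnable relative to $x$* if there are $A$ and $m$ witnessing PAC learnability of $\mathcal H$, where $A(S)$ need not lie in $\mathcal H$, such that $(S,k)\mapsto A(S)(k)$ is computable from $x$ and the restriction of $m$ to rational arguments is computable from $x$. **Theorem.** Let $x\mapsto\mathcal H_x$ assign a hypothesis class to each $x\in 2^{\mathbb N}$ and be degree-invariant, i.e. $x\equiv_T y$ implies $\mathcal H_x=\mathcal H_y$. Assume that for every sample $S=((n_1,y_1),\dots,(n_k,y_k))$ the set $$\{x\in 2^{\mathbb N} : \text{there is } h\in\mathcal H_x \text{ with } h(n_i)=y_i \text{ for all } i\le k\}$$ is determined (under AD this holds for every family). If $\mathcal H_x$ is PAC-learnable for all $x$ on a cone, then $\mathcal H_x$ is improperly SCPAC-learnable relative to $x$ for all $x$ on a cone. -/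

import Mathlib

open MeasureTheory

namespace OnACone

/-- Cantor space `2^ℕ`; its points serve as oracles (subsets of `ℕ`) and as hypotheses
`ℕ → {0,1}`. -/
abbrev Cantor : Type := ℕ → Bool

/-! ### Turing reducibility and cones -/

/-- The characteristic function of `x`, as an oracle for Mathlib's relative computability. -/
def oracle (x : Cantor) : ℕ →. ℕ := fun n => Part.some (x n).toNat

/-- `x ≤_T y`. -/
def TuringLE (x y : Cantor) : Prop := TuringReducible (oracle x) (oracle y)

/-- `x ≡_T y`. -/
def TuringEq (x y : Cantor) : Prop := TuringLE x y ∧ TuringLE y x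

/-- `P` holds for all `x` on a cone: there is a base `b` with `P x` for every `x ≥_T b`. -/
def OnCone (P : Cantor → Prop) : Prop := ∃ b : Cantor, ∀ x : Cantor, TuringLE b x → P x

/-! ### Gale–Stewart games -/

/-- The position `(z 0, …, z (n - 1))` reached after `n` moves of the play `z`. -/
def position (z : Cantor) (n : ℕ) : List Bool := (List.range n).map z

/-- A strategy tells its owner which bit to play at each position. -/
abbrev Strategy : Type := List Bool → Bool

/-- `z` is a play in which player I, who makes the moves `0, 2, 4, …`, follows `σ`. -/
def FollowsI (σ : Strategy) (z : Cantor) : Prop :=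
  ∀ n, z (2 * n) = σ (position z (2 * n))

/-- `z` is a play in which player II, who makes the moves `1, 3, 5, …`, follows `τ`. -/
def FollowsII (τ : Strategy) (z : Cantor) : Prop :=
  ∀ n, z (2 * n + 1) = τ (position z (2 * n + 1))

/-- The game with payoff set `A` (player I wins the play `z` iff `z ∈ A`) is determined:
one of the two players has a winning strategy. -/
def Determined (A : Set Cantor) : Prop :=
  (∃ σ : Strategy, ∀ z, FollowsI σ z → z ∈ A) ∨ (∃ τ : Strategy, ∀ z, FollowsII τ z → z ∉ A)

/-- The axiom of determinacy. It contradicts the axiom of choice, so it is not used as a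
hypothesis as it stands, but only through the instances `DeterminedTraces` below. -/
def AxiomOfDeterminacy : Prop := ∀ A : Set Cantor, Determined A

/-! ### PAC learning -/

/-- A sample: a finite sequence of feature-label pairs. -/
abbrev Sample : Type := List (ℕ × Bool)

/-- An arbitrary map from samples to hypotheses. -/
abbrev Learner : Type := Sample → Cantor

/-- The true error `L_D(h) = Pr_{(n, y) ∼ D} [h n ≠ y]`. -/
noncomputable def trueError (D : Measure (ℕ × Bool)) (h : Cantor) : ℝ :=
  D.real {p | h p.1 ≠ p.2}

/-- The learner `A`, with sample size function `m` (of which only the values on `(0,1)²`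
matter), satisfies the agnostic PAC guarantee for the hypothesis class `H`. The condition
`L_D(A S) ≤ inf_{h ∈ H} L_D(h) + ε` is written as `L_D(A S) ≤ L_D(h) + ε` for all `h ∈ H`. -/
def IsPACWitness (H : Set Cantor) (A : Learner) (m : ℝ → ℝ → ℕ) : Prop :=
  ∀ D : Measure (ℕ × Bool), IsProbabilityMeasure D →
    ∀ ε ∈ Set.Ioo (0 : ℝ) 1, ∀ δ ∈ Set.Ioo (0 : ℝ) 1, ∀ n : ℕ, m ε δ ≤ n →
      1 - δ ≤ (Measure.pi fun _ : Fin n => D).real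
        {S | ∀ h ∈ H, trueError D (A (List.ofFn S)) ≤ trueError D h + ε}

/-- (Proper) PAC learnability: the learner outputs elements of `H`. -/
def PACLearnable (H : Set Cantor) : Prop :=
  ∃ (A : Learner) (m : ℝ → ℝ → ℕ), (∀ S, A S ∈ H) ∧ IsPACWitness H A m

/-- The learner `A` is `x`-computable: an `x`-program computes, uniformly in the sample `S`,
the hypothesis `A S`. -/
def LearnerComputableIn (x : Cantor) (A : Learner) : Prop :=
  ComputableIn {oracle x} fun p : Sample × ℕ => A p.1 p.2

/-- The sample size function `m` is `x`-computable: an `x`-program computes `m ε δ` from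
rational `ε` and `δ`, given as fractions `a / b` and `c / d` of natural numbers. -/
def SampleSizeComputableIn (x : Cantor) (m : ℝ → ℝ → ℕ) : Prop :=
  ComputableIn {oracle x} fun q : (ℕ × ℕ) × (ℕ × ℕ) =>
    m ((q.1.1 : ℝ) / (q.1.2 : ℝ)) ((q.2.1 : ℝ) / (q.2.2 : ℝ))

/-- `H` is improperly SCPAC learnable relative to `x`: an `x`-computable learner, whose outputs
need not lie in `H`, and an `x`-computable sample size function witness PAC learnability. -/
def ImproperlySCPACLearnable (x : Cantor) (H : Set Cantor) : Prop :=
  ∃ (A : Learner) (m : ℝ → ℝ → ℕ),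
    LearnerComputableIn x A ∧ SampleSizeComputableIn x m ∧ IsPACWitness H A m

/-! ### Families of hypothesis classes -/

/-- `x ↦ H x` is degree-invariant. -/
def DegreeInvariant (H : Cantor → Set Cantor) : Prop := ∀ x y, TuringEq x y → H x = H y

/-- For each finite list `S` of feature-label pairs, the set of all `x` such that some
hypothesis in `H x` is correct on all of `S` is determined. -/
def DeterminedTraces (H : Cantor → Set Cantor) : Prop :=
  ∀ S : Sample, Determined {x | ∃ h ∈ H x, ∀ p ∈ S, h p.1 = p.2}

/-- Under the axiom of determinacy this is no restriction on the family. -/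
theorem AxiomOfDeterminacy.determinedTraces (hAD : AxiomOfDeterminacy)
    (H : Cantor → Set Cantor) : DeterminedTraces H :=
  fun _ => hAD _

end OnACone

/-! The PAC guarantee for a class depends only on its finite traces: every distribution on `ℕ ×
Bool` has small mass beyond some `N`, so the infimum of the errors is decided by finite patterns
(`IsPACWitness.of_realizes`). For each sample, being realized is a degree-invariant determined
property, hence constant on a cone by Martin's theorem (`Determined.onCone`). There are countably
many samples, so all traces are constant on one cone (`OnCone.all`). A learner for a single class on
that cone therefore works for all of them, and it is computable, with its sample size, from every
oracle high enough to encode both. Its outputs lie in the one chosen class, so it may be improper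
for the others. -/

/-! ### Relative computability of total functions -/

namespace ComputableIn

variable {α β γ : Type*} [Primcodable α] [Primcodable β] [Primcodable γ] {O : Set (ℕ →. ℕ)}

theorem of_eq {f g : α → β} (hf : ComputableIn O f) (h : ∀ a, f a = g a) : ComputableIn O g :=
  (funext h : f = g) ▸ hf

theorem comp {f : β → γ} {g : α → β} (hf : ComputableIn O f) (hg : ComputableIn O g) :
    ComputableIn O fun a => f (g a) :=
  (Nat.RecursiveIn.comp hf hg).of_eq fun n => by
    cases Encodable.decode (α := α) n <;> simp

theorem pair {f : α → β} {g : α → γ} (hf : ComputableIn O f) (hg : ComputableIn O g) :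
    ComputableIn O fun a => (f a, g a) :=
  (Nat.RecursiveIn.pair hf hg).of_eq fun n => by
    cases Encodable.decode (α := α) n <;> simp [Seq.seq]

theorem comp₂ {δ : Type*} [Primcodable δ] {f : β → γ → δ} {g : α → β} {h : α → γ}
    (hf : Primrec₂ f) (hg : ComputableIn O g) (hh : ComputableIn O h) :
    ComputableIn O fun a => f (g a) (h a) :=
  comp (f := fun p : β × γ => f p.1 p.2) hf.computableIn (hg.pair hh)

theorem cond {c : α → Bool} {f g : α → β} (hc : ComputableIn O c) (hf : ComputableIn O f)
    (hg : ComputableIn O g) : ComputableIn O fun a => bif c a then f a else g a :=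
  comp (f := fun p : Bool × β × β => bif p.1 then p.2.1 else p.2.2)
    (Primrec.cond Primrec.fst (Primrec.fst.comp Primrec.snd)
      (Primrec.snd.comp Primrec.snd)).computableIn (hc.pair (hf.pair hg))

/-- Closure under primitive recursion without parameters. -/
theorem nat_rec (s : α) {g : ℕ × α → α} (hg : ComputableIn O g) :
    ComputableIn O fun n : ℕ => (Nat.rec s (fun k ih => g (k, ih)) n : α) := by
  have hs : ComputableIn O fun _ : ℕ => s := ComputableIn.const s
  have hg' : ComputableIn O fun p : ℕ × ℕ × α => g p.2 := hg.comp ComputableIn.snd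
  -- The `prec` scheme expects a parameter; 0 is a dummy.
  have h0 : ComputableIn O fun n : ℕ => Nat.pair 0 n :=
    comp₂ Primrec₂.natPair (ComputableIn.const 0) ComputableIn.id
  refine (Nat.RecursiveIn.comp (Nat.RecursiveIn.prec hs hg') h0).of_eq fun n => ?_
  simp only [Encodable.decode_nat, Part.coe_some, Part.bind_some, Part.map_some,
    Encodable.encode_nat, Part.bind_eq_bind, Nat.unpair_pair]
  induction n with
  | zero => simp
  | succ n ih => simp only [ih]; simp

end ComputableIn

namespace OnACone

theorem turingLE_iff {x y : Cantor} : TuringLE y x ↔ ComputableIn {oracle x} y := by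
  have h : (fun n => (Part.some (y n)).map Encodable.encode) = oracle y := by
    funext n
    cases h : y n <;> simp [oracle, h]
  rw [TuringLE, TuringReducible, RecursiveIn.iff_nat, ← h]
  simp [ComputableIn, RecursiveIn]

theorem TuringLE.refl (x : Cantor) : TuringLE x x := TuringReducible.refl _

theorem computableIn_self (x : Cantor) : ComputableIn {oracle x} x :=
  turingLE_iff.1 (.refl x)

theorem onCone_computableIn_bool {α : Type*} [Primcodable α] (f : α → Bool) :
    OnCone fun x => ComputableIn {oracle x} f := by
  refine ⟨fun n => (Encodable.decode (α := α) n).elim false f, fun x hx => ?_⟩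
  exact ((turingLE_iff.1 hx).comp Primrec.encode.computableIn).of_eq fun a => by simp

theorem onCone_computableIn_nat {α : Type*} [Primcodable α] (f : α → ℕ) :
    OnCone fun x => ComputableIn {oracle x} f := by
  let g : ℕ → ℕ := fun n => (Encodable.decode (α := α) n).elim 0 f
  -- The oracle encodes the graph of `g`, and unbounded search recovers its values. The test is `≠`
  -- because `rfind` looks for 0, the code of `false`.
  obtain ⟨b, hb⟩ := onCone_computableIn_bool fun p : ℕ => decide (p.unpair.2 ≠ g p.unpair.1)
  refine ⟨b, fun x hx => ?_⟩
  have hg : ComputableIn {oracle x} g := by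
    refine (Nat.RecursiveIn.rfind (hb x hx)).of_eq fun a => ?_
    have hmem := Part.eq_some_iff.2 (Nat.mem_rfind
      (p := fun n => Part.some (decide ((decide (n ≠ g a)).toNat = 0))) (n := g a) |>.2
        ⟨by simp, fun {m} hm => by simp [hm.ne]⟩)
    refine Eq.trans (congrArg Nat.rfind (funext fun n => ?_)) (hmem.trans (by simp))
    by_cases h : n = g a <;> simp [h]
  exact (hg.comp Primrec.encode.computableIn).of_eq fun a => by simp [g]

/-- Countably many bases have a common upper bound, their join. -/
theorem OnCone.all {ι : Type*} [Primcodable ι] {P : ι → Cantor → Prop}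
    (h : ∀ i, OnCone (P i)) : OnCone fun x => ∀ i, P i x := by
  choose b hb using h
  obtain ⟨c, hc⟩ := onCone_computableIn_bool fun p : ι × ℕ => b p.1 p.2
  exact ⟨c, fun x hx i => hb i x <| turingLE_iff.2 <|
    (hc x hx).comp ((ComputableIn.const i).pair ComputableIn.id)⟩

theorem OnCone.and {P Q : Cantor → Prop} (hP : OnCone P) (hQ : OnCone Q) :
    OnCone fun x => P x ∧ Q x := by
  obtain ⟨b, hb⟩ := OnCone.all (P := fun i : Bool => bif i then P else Q)
    (Bool.forall_bool.2 ⟨hQ, hP⟩)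
  exact ⟨b, fun x hx => ⟨hb x hx true, hb x hx false⟩⟩

/-! ### Martin's cone theorem -/

/-- The move made at position `l`, at stage `n`, when the owner of the stages of parity `e`
follows `σ` and the opponent plays the bits of `x` in turn. -/
def move (e : Bool) (σ : Strategy) (x : Cantor) (n : ℕ) (l : List Bool) : Bool :=
  bif n.bodd == e then σ l else x n.div2

/-- The positions of the play described at `move`. -/
def playPosition (e : Bool) (σ : Strategy) (x : Cantor) (n : ℕ) : List Bool :=
  Nat.rec [] (fun k l => l ++ [move e σ x k l]) n

/-- The play described at `move`. -/
def play (e : Bool) (σ : Strategy) (x : Cantor) : Cantor :=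
  fun n => move e σ x n (playPosition e σ x n)

theorem position_play (e : Bool) (σ : Strategy) (x : Cantor) (n : ℕ) :
    position (play e σ x) n = playPosition e σ x n := by
  induction n with
  | zero => rfl
  | succ n ih =>
    rw [position, List.range_succ, List.map_append, ← position, ih]
    rfl

theorem play_of_bodd_eq {e : Bool} (σ : Strategy) (x : Cantor) {n : ℕ} (h : n.bodd = e) :
    play e σ x n = σ (position (play e σ x) n) := by
  rw [position_play]
  simp [play, move, h]

theorem play_of_bodd_ne {e : Bool} (σ : Strategy) (x : Cantor) {n : ℕ} (h : n.bodd ≠ e) :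
    play e σ x n = x n.div2 := by
  rw [play, move, beq_false_of_ne h, cond_false]

theorem followsI_play (σ : Strategy) (x : Cantor) : FollowsI σ (play false σ x) :=
  fun n => play_of_bodd_eq σ x (by simp)

theorem followsII_play (τ : Strategy) (x : Cantor) : FollowsII τ (play true τ x) :=
  fun n => play_of_bodd_eq τ x (by simp)

theorem computableIn_move (e : Bool) {σ : Strategy} {x : Cantor}
    (hσ : ComputableIn {oracle x} σ) :
    ComputableIn {oracle x} fun p : ℕ × List Bool => move e σ x p.1 p.2 := by
  have hparity : ComputableIn {oracle x} fun p : ℕ × List Bool => p.1.bodd == e :=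
    (Primrec.beq.comp (Primrec.nat_bodd.comp Primrec.fst) (Primrec.const e)).computableIn
  have hx : ComputableIn {oracle x} fun p : ℕ × List Bool => x p.1.div2 :=
    (computableIn_self x).comp (Primrec.nat_div2.comp Primrec.fst).computableIn
  exact hparity.cond (hσ.comp ComputableIn.snd) hx

theorem computableIn_playPosition (e : Bool) {σ : Strategy} {x : Cantor}
    (hσ : ComputableIn {oracle x} σ) : ComputableIn {oracle x} (playPosition e σ x) := by
  have hstep : ComputableIn {oracle x} fun p : ℕ × List Bool => p.2 ++ [move e σ x p.1 p.2] :=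
    ComputableIn.comp₂ (f := fun (l : List Bool) a => l ++ [a]) Primrec.list_concat
      ComputableIn.snd (computableIn_move e hσ)
  exact ComputableIn.nat_rec [] hstep

theorem turingLE_play (e : Bool) (σ : Strategy) (x : Cantor) : TuringLE x (play e σ x) := by
  -- The opponent's `n`-th move, which is `x n`.
  have hidx : Primrec fun n : ℕ => 2 * n + (!e).toNat :=
    Primrec.nat_add.comp (Primrec.nat_mul.comp (Primrec.const 2) Primrec.id)
      (Primrec.const (!e).toNat)
  refine turingLE_iff.2 <|
    ((computableIn_self (play e σ x)).comp hidx.computableIn).of_eq fun n => ?_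
  rw [play_of_bodd_ne]
  · have hdiv : (2 * n + (!e).toNat).div2 = n := by
      cases e <;> simp only [Nat.div2_val, Bool.not_false, Bool.not_true, Bool.toNat_true,
        Bool.toNat_false] <;> omega
    rw [hdiv]
  · cases e <;> simp

theorem computableIn_play (e : Bool) {σ : Strategy} {x : Cantor}
    (hσ : ComputableIn {oracle x} σ) : ComputableIn {oracle x} (play e σ x) := by
  have hpair : ComputableIn {oracle x} fun n => (n, playPosition e σ x n) :=
    ComputableIn.id.pair (computableIn_playPosition e hσ)
  exact ((computableIn_move e hσ).comp hpair).of_eq fun n => by rw [play]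

theorem turingEq_play (e : Bool) {σ : Strategy} {x : Cantor} (hσ : ComputableIn {oracle x} σ) :
    TuringEq x (play e σ x) :=
  ⟨turingLE_play e σ x, turingLE_iff.2 (computableIn_play e hσ)⟩

/-- Martin's cone theorem, for a single determined set. -/
theorem Determined.onCone {A : Set Cantor} (hA : Determined A)
    (hinv : ∀ x y, TuringEq x y → (x ∈ A ↔ y ∈ A)) :
    OnCone (fun x => x ∈ A) ∨ OnCone fun x => x ∉ A := by
  rcases hA with ⟨σ, hσ⟩ | ⟨τ, hτ⟩
  · obtain ⟨b, hb⟩ := onCone_computableIn_bool σ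
    -- If `x` computes the winning strategy, the play against the bits of `x` is won and has the
    -- degree of `x`.
    exact .inl ⟨b, fun x hx =>
      (hinv _ _ (turingEq_play false (hb x hx))).2 (hσ _ (followsI_play σ x))⟩
  · obtain ⟨b, hb⟩ := onCone_computableIn_bool τ
    exact .inr ⟨b, fun x hx h =>
      hτ _ (followsII_play τ x) ((hinv _ _ (turingEq_play true (hb x hx))).1 h)⟩

/-! ### Hypothesis classes with the same traces -/

/-- Some hypothesis in `H` is correct on all of `S`. -/
def Realizes (H : Set Cantor) (S : Sample) : Prop := ∃ h ∈ H, ∀ p ∈ S, h p.1 = p.2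

theorem trueError_le_of_agree {D : Measure (ℕ × Bool)} [IsProbabilityMeasure D] {h h' : Cantor}
    {N : ℕ} (hN : ∀ n < N, h n = h' n) :
    trueError D h ≤ trueError D h' + D.real {p | N ≤ p.1} := by
  refine (measureReal_mono fun p hp => ?_).trans (measureReal_union_le _ _)
  by_cases hpN : N ≤ p.1
  · exact .inr hpN
  · exact .inl fun h0 => hp ((hN _ (not_le.1 hpN)).trans h0)

theorem exists_tail_lt (D : Measure (ℕ × Bool)) [IsProbabilityMeasure D] {η : ℝ} (hη : 0 < η) :
    ∃ N : ℕ, D.real {p | N ≤ p.1} < η := by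
  have hanti : Antitone fun N : ℕ => {p : ℕ × Bool | N ≤ p.1} :=
    fun _ _ hMN _ hp => le_trans hMN hp
  have hempty : (⋂ N : ℕ, {p : ℕ × Bool | N ≤ p.1}) = ∅ :=
    Set.eq_empty_of_forall_notMem fun p hp =>
      absurd (Set.mem_iInter.1 hp (p.1 + 1)) (Nat.not_succ_le_self p.1)
  have hlim := tendsto_measure_iInter_atTop (μ := D)
    (fun N => (Set.to_countable {p : ℕ × Bool | N ≤ p.1}).measurableSet.nullMeasurableSet)
    hanti ⟨0, measure_ne_top _ _⟩
  rw [hempty, measure_empty] at hlim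
  have hreal := (ENNReal.tendsto_toReal ENNReal.zero_ne_top).comp hlim
  exact (hreal.eventually (gt_mem_nhds hη)).exists

/-- A hypothesis all of whose finite restrictions are realized by `H` has true error at least
the infimum of the true errors over `H`. -/
theorem exists_trueError_lt {H H' : Set Cantor} (hH : ∀ S, Realizes H' S → Realizes H S)
    (D : Measure (ℕ × Bool)) [IsProbabilityMeasure D] {h' : Cantor} (hh' : h' ∈ H') {η : ℝ}
    (hη : 0 < η) : ∃ h ∈ H, trueError D h < trueError D h' + η := by
  obtain ⟨N, hN⟩ := exists_tail_lt D hη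
  obtain ⟨h, hh, hagree⟩ := hH ((List.range N).map fun n => (n, h' n)) ⟨h', hh', by simp⟩
  refine ⟨h, hh, (trueError_le_of_agree (N := N) fun n hn => ?_).trans_lt (by gcongr)⟩
  exact hagree (n, h' n) (List.mem_map.2 ⟨n, List.mem_range.2 hn, rfl⟩)

theorem IsPACWitness.of_realizes {H H' : Set Cantor} (hH : ∀ S, Realizes H' S → Realizes H S)
    {A : Learner} {m : ℝ → ℝ → ℕ} (hA : IsPACWitness H A m) : IsPACWitness H' A m := by
  intro D hD ε hε δ hδ n hn
  refine (hA D hD ε hε δ hδ n hn).trans (measureReal_mono fun S hS h' hh' => ?_)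
  -- The slack `η` is needed because `H` may only approximate `h'`.
  refine le_of_forall_pos_le_add fun η hη => ?_
  obtain ⟨h, hh, hlt⟩ := exists_trueError_lt hH D hh' hη
  linarith [hS h hh]

theorem onCone_forall_realizes_iff {H : Cantor → Set Cantor} (hdet : DeterminedTraces H)
    (hinv : DegreeInvariant H) : ∃ T : Set Sample, OnCone fun x => ∀ S, Realizes (H x) S ↔ S ∈ T := by
  have h : ∀ S, ∃ t : Prop, OnCone fun x => Realizes (H x) S ↔ t := fun S => by
    rcases (hdet S).onCone fun x y hxy => by simp [hinv x y hxy] with ⟨b, hb⟩ | ⟨b, hb⟩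
    · exact ⟨True, b, fun x hx => iff_true_intro (hb x hx)⟩
    · exact ⟨False, b, fun x hx => iff_false_intro (hb x hx)⟩
  choose t ht using h
  exact ⟨{S | t S}, OnCone.all ht⟩

end OnACone

theorem theorem4p6 (H : OnACone.Cantor → Set OnACone.Cantor)
    (hdet : OnACone.DeterminedTraces H)
    (hinv : OnACone.DegreeInvariant H)
    (hPAC : OnACone.OnCone fun x => OnACone.PACLearnable (H x)) :
    OnACone.OnCone fun x => OnACone.ImproperlySCPACLearnable x (H x) := by
  obtain ⟨T, hT⟩ := OnACone.onCone_forall_realizes_iff hdet hinv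
  obtain ⟨b, hb⟩ := hT.and hPAC
  -- One learner, for the class at `b`, will serve the whole cone; properness is dropped here.
  obtain ⟨hTb, A, m, -, hAm⟩ := hb b (.refl b)
  obtain ⟨c, hc⟩ := hT.and <|
    (OnACone.onCone_computableIn_bool fun p : OnACone.Sample × ℕ => A p.1 p.2).and <|
    OnACone.onCone_computableIn_nat fun q : (ℕ × ℕ) × (ℕ × ℕ) =>
      m ((q.1.1 : ℝ) / (q.1.2 : ℝ)) ((q.2.1 : ℝ) / (q.2.2 : ℝ))
  refine ⟨c, fun x hx => ?_⟩
  obtain ⟨hTx, hAx, hmx⟩ := hc x hx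
  exact ⟨A, m, hAx, hmx, hAm.of_realizes fun S hS => (hTb S).2 ((hTx S).1 hS)⟩
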